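/- A ring $R$ with identity is called nil-clean if for every $a \in R$ there is an idempotent $e \in R$ such that $a - e$ is nilpotent. Let $m \ge 2$ and $n \ge 1$ be integers, and let $M_n(\mathbb{Z}_m)$ be the ring of all $n \times n$ matrices over $\mathbb{Z}_m = \mathbb{Z}/m\mathbb{Z}$. Then $M_n(\mathbb{Z}_m)$ is nil-clean if and only if $m = 2^r$ for some integer $r \ge 1$. -/

import Mathlib

/-- An element `a` of a ring is nil-clean if `a - e` is nilpotent for some idempotent `e`. -/
def IsNilClean {R : Type*} [Ring R] (a : R) : Prop :=
  ∃ e : R, IsIdempotentElem e ∧ IsNilpotent (a - e)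

/-- A ring is nil-clean if each of its elements is nil-clean. -/
def IsNilCleanRing (R : Type*) [Ring R] : Prop :=
  ∀ a : R, IsNilClean a

/-! If `2 - e` is nilpotent with `e` idempotent, then `(2 - e) * e = e` makes `e` nilpotent, so `e =
0` and `2` is nilpotent; hence `m` divides a power of two. Conversely, reduction modulo 2 has nil
kernel and idempotents lift, so matrices over the field with two elements suffice. By induction on
dimension, an invariant subspace splits the problem into subspace and quotient
(`isNilClean_of_invariant`). Without one, any `v ≠ 0` is cyclic. In the Newton basis `q_i(f) v`, `f`
is a nilpotent shift plus an `e` that is diagonal except in its last column; the trace and the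
absence of eigenvalues let the nodes be chosen so that `e` is idempotent. -/

/-- In a nil-clean ring the element `2` is nilpotent. -/
theorem IsNilCleanRing.isNilpotent_two {R : Type*} [Ring R] (h : IsNilCleanRing R) :
    IsNilpotent (2 : R) := by
  obtain ⟨e, he, hb⟩ := h 2
  have hee : e * e = e := he
  have hmul : (2 - e) * e = e := by
    rw [sub_mul, hee, two_mul, add_sub_cancel_right]
  have hcomm : Commute (2 - e) e := by
    rw [Commute, SemiconjBy, hmul, mul_sub, hee, mul_two, add_sub_cancel_right]
  have hnil : IsNilpotent e := by
    rw [← hmul]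
    exact hcomm.isNilpotent_mul_right hb
  simpa [he.eq_zero_of_isNilpotent hnil] using hb

/-- Nil-cleanness descends along a surjection whose kernel is nil. -/
theorem IsNilCleanRing.of_surjective_of_ker_isNilpotent {R S : Type*} [Ring R] [Ring S]
    (φ : R →+* S) (hφ : Function.Surjective φ) (hker : ∀ x ∈ RingHom.ker φ, IsNilpotent x)
    (h : IsNilCleanRing S) : IsNilCleanRing R := by
  intro a
  obtain ⟨e, he, k, hk⟩ := h (φ a)
  obtain ⟨e', he', rfl⟩ := exists_isIdempotentElem_eq_of_ker_isNilpotent φ hker e (hφ e) he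
  refine ⟨e', he', ?_⟩
  have hmem : (a - e') ^ k ∈ RingHom.ker φ := by
    rw [RingHom.mem_ker, map_pow, map_sub, hk]
  exact (hker _ hmem).of_pow

/-- Nil-cleanness transports along ring isomorphisms. -/
theorem IsNilCleanRing.of_ringEquiv {R S : Type*} [Ring R] [Ring S] (φ : R ≃+* S)
    (h : IsNilCleanRing S) : IsNilCleanRing R := by
  refine h.of_surjective_of_ker_isNilpotent (φ : R →+* S) φ.surjective fun x hx => ?_
  have hx0 : φ x = 0 := hx
  rw [(map_eq_zero_iff φ φ.injective).1 hx0]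
  exact IsNilpotent.zero

/-! ### Extensions by invariant subspaces -/

/-- Nil-clean endomorphisms are closed under extensions. -/
theorem isNilClean_of_invariant {F V : Type*} [Field F] [AddCommGroup V] [Module F V]
    (f : Module.End F V) (W : Submodule F V) (hW : W ≤ W.comap f)
    (h₁ : IsNilClean (f.restrict hW : Module.End F W))
    (h₂ : IsNilClean (W.mapQ W f hW : Module.End F (V ⧸ W))) : IsNilClean f := by
  obtain ⟨e₁, he₁, k, hk⟩ := h₁
  obtain ⟨e₂, he₂, l, hl⟩ := h₂
  obtain ⟨s, hs⟩ := W.mkQ.exists_rightInverse_of_surjective W.range_mkQ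
  have hs' : ∀ y, W.mkQ (s y) = y := fun y => LinearMap.congr_fun hs y
  -- Projection onto `W` along the complement `s (V ⧸ W)`; `e` below is block diagonal for this
  -- splitting.
  let ρ : V →ₗ[F] W := (LinearMap.id - s ∘ₗ W.mkQ).codRestrict W fun x => by
    refine (Submodule.Quotient.mk_eq_zero W).1 ?_
    change W.mkQ _ = 0
    simp [-Submodule.mkQ_apply, hs']
  have hπW : ∀ w : W, W.mkQ (w : V) = 0 := fun w => by simp
  have hρW : ∀ w : W, ρ (w : V) = w := fun w => Subtype.ext <| by
    simp [ρ, -Submodule.mkQ_apply, hπW]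
  have hρs : ∀ y, ρ (s y) = 0 := fun y => Subtype.ext <| by
    simp [ρ, -Submodule.mkQ_apply, hs']
  let e : Module.End F V := W.subtype ∘ₗ e₁ ∘ₗ ρ + s ∘ₗ e₂ ∘ₗ W.mkQ
  have he : ∀ x, e x = (e₁ (ρ x) : V) + s (e₂ (W.mkQ x)) := fun x => rfl
  have he₁' : ∀ w, e₁ (e₁ w) = e₁ w := fun w => LinearMap.congr_fun he₁ w
  have he₂' : ∀ y, e₂ (e₂ y) = e₂ y := fun y => LinearMap.congr_fun he₂ y
  refine ⟨e, ?_, k + l, ?_⟩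
  · ext x
    change e (e x) = e x
    rw [he (e x), he x, map_add ρ, map_add W.mkQ, hρW, hρs, hπW, hs', add_zero, zero_add, he₁', he₂']
  have hsub : ∀ (j : ℕ) (w : W),
      ((f - e) ^ j) (w : V) = (((f.restrict hW - e₁ : Module.End F W) ^ j) w : V) := by
    intro j
    induction j with
    | zero => intro w; rfl
    | succ j ih =>
      intro w
      rw [pow_succ, pow_succ, Module.End.mul_apply, Module.End.mul_apply, ← ih]
      congr 1
      rw [LinearMap.sub_apply, he, hρW, hπW, map_zero, map_zero, add_zero]
      rfl
  have hquot : ∀ (j : ℕ) (x : V),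
      W.mkQ (((f - e) ^ j) x) = ((W.mapQ W f hW - e₂ : Module.End F (V ⧸ W)) ^ j) (W.mkQ x) := by
    intro j
    induction j with
    | zero => intro x; rfl
    | succ j ih =>
      intro x
      rw [pow_succ, pow_succ, Module.End.mul_apply, Module.End.mul_apply, ih]
      congr 1
      rw [LinearMap.sub_apply, he, map_sub, map_add, hπW, hs', zero_add]
      rfl
  ext x
  rw [pow_add, Module.End.mul_apply, LinearMap.zero_apply]
  have hmem : ((f - e) ^ l) x ∈ W := by
    rw [← Submodule.ker_mkQ W, LinearMap.mem_ker, hquot, hl, LinearMap.zero_apply]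
  have := hsub k ⟨_, hmem⟩
  rw [hk] at this
  simpa using this

/-! ### Endomorphisms without proper invariant subspaces -/

section Irreducible

open Polynomial Module

/-- The Newton polynomials `∏_{j < i} (X - d j)`. -/
noncomputable def newtonPoly {F : Type*} [Field F] (d : ℕ → F) : ℕ → F[X]
  | 0 => 1
  | i + 1 => (X - C (d i)) * newtonPoly d i

theorem newtonPoly_monic {F : Type*} [Field F] (d : ℕ → F) (i : ℕ) : (newtonPoly d i).Monic := by
  induction i with
  | zero => exact monic_one
  | succ i ih => exact (monic_X_sub_C _).mul ih

theorem newtonPoly_natDegree {F : Type*} [Field F] (d : ℕ → F) (i : ℕ) :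
    (newtonPoly d i).natDegree = i := by
  induction i with
  | zero => exact natDegree_one
  | succ i ih =>
    rw [newtonPoly, (monic_X_sub_C _).natDegree_mul (newtonPoly_monic d i), ih, natDegree_X_sub_C,
      add_comm]

theorem newtonPoly_eval_eq_zero {F : Type*} [Field F] (d : ℕ → F) {j i : ℕ} (h : j < i) :
    (newtonPoly d i).eval (d j) = 0 := by
  induction i with
  | zero => omega
  | succ i ih =>
    rw [newtonPoly, eval_mul]
    rcases Nat.lt_succ_iff_lt_or_eq.1 h with h | rfl
    · rw [ih h, mul_zero]
    · simp

/-- The Newton polynomials as a polynomial sequence. -/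
noncomputable def newtonSequence {F : Type*} [Field F] (d : ℕ → F) : Polynomial.Sequence F where
  elems' := newtonPoly d
  degree_eq' i := by
    rw [degree_eq_natDegree (newtonPoly_monic d i).ne_zero, newtonPoly_natDegree]

variable {F V : Type*} [Field F] [AddCommGroup V] [Module F V]

/-- The endomorphism `f` has no invariant subspaces other than `⊥` and `⊤`. -/
def HasOnlyTrivialInvariants (f : Module.End F V) : Prop :=
  ∀ W : Submodule F V, W ≤ W.comap f → W = ⊥ ∨ W = ⊤

/-- The kernel of `r(f)` is invariant and contains `v ≠ 0`, so it is everything. -/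
theorem HasOnlyTrivialInvariants.aeval_eq_zero {f : Module.End F V}
    (hf : HasOnlyTrivialInvariants f) {v : V} (hv : v ≠ 0) {r : F[X]} (h : aeval f r v = 0) :
    aeval f r = 0 := by
  have hcomm : ∀ x, aeval f r (f x) = f (aeval f r x) := fun x => by
    rw [← Module.End.mul_apply, ← Module.End.mul_apply]
    congr 1
    have := map_mul (aeval f) r X
    rwa [mul_comm, map_mul, aeval_X, eq_comm] at this
  rcases hf (LinearMap.ker (aeval f r)) (fun x hx => by
    rw [LinearMap.mem_ker] at hx
    rw [Submodule.mem_comap, LinearMap.mem_ker, hcomm, hx, map_zero]) with hb | ht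
  · exact absurd ((Submodule.mem_bot F).1 (hb ▸ LinearMap.mem_ker.2 h)) hv
  · exact LinearMap.ker_eq_top.1 ht

/-- The vector `v` is cyclic. Were `r(f) v = 0`, then `r(f) = 0`, and remainders modulo `r` would
span `V` in too small a dimension. -/
theorem HasOnlyTrivialInvariants.aeval_apply_ne_zero {f : Module.End F V}
    (hf : HasOnlyTrivialInvariants f) {v : V} (hv : v ≠ 0) {r : F[X]}
    (hr : r ≠ 0) (hdeg : r.natDegree < finrank F V) : aeval f r v ≠ 0 := by
  intro h
  have h0 := hf.aeval_eq_zero hv h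
  let φ : F[X] →ₗ[F] V := (LinearMap.applyₗ v) ∘ₗ (aeval f : F[X] →ₐ[F] Module.End F V).toLinearMap
  have hφ : ∀ s, φ s = aeval f s v := fun s => rfl
  have htop : LinearMap.range φ = ⊤ := by
    refine (hf _ ?_).resolve_left fun hb => hv ?_
    · rintro _ ⟨s, rfl⟩
      exact ⟨X * s, by rw [hφ, hφ, map_mul, aeval_X, Module.End.mul_apply]⟩
    · rw [← Submodule.mem_bot F, ← hb]
      exact ⟨1, by simp [hφ]⟩
  have hsurj : Function.Surjective (φ ∘ₗ (degreeLT F r.natDegree).subtype) := by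
    intro x
    obtain ⟨s, rfl⟩ := LinearMap.range_eq_top.1 htop x
    refine ⟨⟨s % r, mem_degreeLT.2 ?_⟩, ?_⟩
    · rw [← degree_eq_natDegree hr]
      exact EuclideanDomain.mod_lt s hr
    · change aeval f (s % r) v = aeval f s v
      conv_rhs => rw [← EuclideanDomain.mod_add_div s r]
      simp [h0]
  have hfin : FiniteDimensional F (degreeLT F r.natDegree) :=
    (degreeLTEquiv F r.natDegree).symm.finiteDimensional
  have := LinearMap.finrank_le_finrank_of_surjective hsurj
  rw [(degreeLTEquiv F r.natDegree).finrank_eq, finrank_fin_fun] at this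
  omega

/-- A relation of degree at most `dim V` has no roots, unless `f` has an eigenvalue. -/
theorem HasOnlyTrivialInvariants.eval_ne_zero {f : Module.End F V}
    (hf : HasOnlyTrivialInvariants f) {v : V} (hv : v ≠ 0) {r : F[X]}
    (hr : r ≠ 0) (hdeg : r.natDegree ≤ finrank F V) (h : aeval f r v = 0) {a : F}
    (ha : ∀ x, f x = a • x → x = 0) : r.eval a ≠ 0 := by
  intro h0
  obtain ⟨s, rfl⟩ := dvd_iff_isRoot.2 h0
  have hs : s ≠ 0 := right_ne_zero_of_mul hr
  rw [(monic_X_sub_C a).natDegree_mul' hs, natDegree_X_sub_C] at hdeg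
  refine hf.aeval_apply_ne_zero hv hs (by omega) (ha _ ?_)
  rw [← sub_eq_zero]
  simpa [Module.End.mul_apply] using h

/-- The basis `q_i(f) v` of Newton polynomials. -/
theorem HasOnlyTrivialInvariants.exists_basis {f : Module.End F V}
    (hf : HasOnlyTrivialInvariants f) {v : V} (hv : v ≠ 0) {k : ℕ} (hk : finrank F V = k + 1)
    (d : ℕ → F) :
    ∃ b : Basis (Fin (k + 1)) F V, ∀ i, b i = aeval f (newtonPoly d i) v := by
  have hli : LinearIndependent F fun i : Fin (k + 1) => aeval f (newtonPoly d i) v := by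
    rw [Fintype.linearIndependent_iff]
    intro g hg
    refine Fintype.linearIndependent_iff.1
      ((newtonSequence d).linearIndependent.comp (Fin.val : Fin (k + 1) → ℕ) Fin.val_injective) g ?_
    by_contra hne
    refine hf.aeval_apply_ne_zero hv hne ?_ ?_
    · refine lt_of_le_of_lt (natDegree_sum_le_of_forall_le (n := k) _ _ fun i _ => ?_) (by omega)
      refine (natDegree_smul_le _ _).trans ?_
      rw [Function.comp_apply, Polynomial.Sequence.natDegree_eq]
      omega
    · rw [← hg]
      simp [newtonSequence]
  exact ⟨basisOfLinearIndependentOfCardEqFinrank hli (by simp [hk]), fun i => by simp⟩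

/-- With `N` the shift of the Newton basis, `f - N` has zero-one diagonal `d` and only its last
column is not diagonal; this gives a criterion for it to be idempotent. -/
theorem HasOnlyTrivialInvariants.isNilClean_of_diagonal {f : Module.End F V}
    (hf : HasOnlyTrivialInvariants f) {v : V} (hv : v ≠ 0) {k : ℕ} (hk : finrank F V = k + 1)
    (d : ℕ → F) (hd : ∀ i, d i * d i = d i)
    (H : ∀ w : Fin (k + 1) → F,
      aeval f (X * newtonPoly d k - ∑ i, C (w i) * newtonPoly d i) v = 0 →
      LinearMap.trace F V f = ∑ i ∈ Finset.range k, d i + w (Fin.last k) →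
      w (Fin.last k) * w (Fin.last k) = w (Fin.last k) ∧
      ∀ i : Fin k, w i.castSucc * d i + w (Fin.last k) * w i.castSucc = w i.castSucc) :
    IsNilClean f := by
  obtain ⟨b, hb⟩ := hf.exists_basis hv hk d
  -- Extending by zero past `k` lets the shift `N` kill the last basis vector with no separate case.
  let β : ℕ → V := fun i => if i < k + 1 then aeval f (newtonPoly d i) v else 0
  have hβlt : ∀ {i}, i < k + 1 → β i = aeval f (newtonPoly d i) v := fun hi => if_pos hi
  have hβge : ∀ {i}, k + 1 ≤ i → β i = 0 := fun hi => if_neg hi.not_gt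
  have hβ : ∀ i : Fin (k + 1), b i = β i := fun i => by rw [hb, hβlt i.2]
  let N : Module.End F V := b.constr F fun i => β (i + 1)
  have hN : ∀ i, N (β i) = β (i + 1) := fun i => by
    by_cases hi : i < k + 1
    · rw [← hβ ⟨i, hi⟩, Basis.constr_basis]
    · rw [hβge (by omega), hβge (by omega), map_zero]
  have hNpow : ∀ j i, (N ^ j) (β i) = β (i + j) := by
    intro j
    induction j with
    | zero => intro i; rfl
    | succ j ih =>
      intro i
      rw [pow_succ, Module.End.mul_apply, hN, ih]
      congr 1
      omega
  have hNnil : IsNilpotent N := ⟨k + 1, b.ext fun i => by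
    rw [hβ, hNpow, hβge (by omega), LinearMap.zero_apply]⟩
  set w := b.repr (f (b (Fin.last k))) with hw
  have hsum : f (b (Fin.last k)) = ∑ i, w i • b i := (b.sum_repr _).symm
  let e : Module.End F V := f - N
  have he : ∀ x, e x = f x - N x := fun x => rfl
  have he_cast : ∀ i : Fin k, e (b i.castSucc) = d i • b i.castSucc := fun i => by
    rw [he, hβ, hN, Fin.val_castSucc, hβlt (by omega), hβlt (by omega)]
    simp [newtonPoly]
  have he_last : e (b (Fin.last k)) = ∑ i, w i • b i := by
    rw [he, ← hsum, hβ, hN, Fin.val_last, hβge le_rfl, sub_zero]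
  have htr : LinearMap.trace F V f = ∑ i ∈ Finset.range k, d i + w (Fin.last k) := by
    have hef : LinearMap.trace F V e = LinearMap.trace F V f := by
      rw [map_sub, (LinearMap.isNilpotent_trace_of_isNilpotent hNnil).eq_zero, sub_zero]
    rw [← hef, LinearMap.trace_eq_matrix_trace F b, Matrix.trace, Fin.sum_univ_castSucc,
      Finset.sum_range]
    congr 1
    · refine Finset.sum_congr rfl fun i _ => ?_
      simp [LinearMap.toMatrix_apply, he_cast]
    · rw [Matrix.diag_apply, LinearMap.toMatrix_apply, he_last, ← hsum]
  obtain ⟨hlast, hcast⟩ := H w (by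
    rw [map_sub, map_mul, aeval_X, LinearMap.sub_apply, Module.End.mul_apply, map_sum,
      LinearMap.sum_apply, sub_eq_zero]
    have := hsum
    simp only [hb, Fin.val_last] at this
    rw [this]
    exact Finset.sum_congr rfl fun i _ => by simp) htr
  refine ⟨e, b.ext fun i => ?_, ?_⟩
  · rw [Module.End.mul_apply]
    induction i using Fin.lastCases with
    | last =>
      rw [he_last, map_sum, Fin.sum_univ_castSucc, Fin.sum_univ_castSucc]
      simp only [map_smul, he_cast, he_last]
      rw [Fin.sum_univ_castSucc, smul_add, Finset.smul_sum, ← add_assoc, ← Finset.sum_add_distrib,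
        smul_smul, hlast]
      congr 1
      refine Finset.sum_congr rfl fun i _ => ?_
      rw [smul_smul, smul_smul, ← add_smul, hcast]
    | cast i => rw [he_cast, map_smul, he_cast, smul_smul, hd]
  · rwa [sub_sub_cancel]

/-- Endomorphisms over the field with two elements without proper invariant subspaces are
nil-clean. -/
theorem HasOnlyTrivialInvariants.isNilClean {V : Type*} [AddCommGroup V] [Module (ZMod 2) V]
    {f : Module.End (ZMod 2) V} (hf : HasOnlyTrivialInvariants f)
    (hpos : 0 < finrank (ZMod 2) V) : IsNilClean f := by
  have := finite_of_finrank_pos hpos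
  have h01 : ∀ a : ZMod 2, a = 0 ∨ a = 1 := by decide
  have hsq : ∀ a : ZMod 2, a * a = a := by decide
  obtain ⟨k, hk⟩ := Nat.exists_eq_succ_of_ne_zero hpos.ne'
  obtain ⟨v, hv⟩ := (finrank_pos_iff_exists_ne_zero (R := ZMod 2) (M := V)).1 hpos
  by_cases heig : ∃ a : ZMod 2, ∃ x : V, f x = a • x ∧ x ≠ 0
  · obtain ⟨a, x, hx, hx0⟩ := heig
    have h0 := hf.aeval_eq_zero hx0 (r := X - C a) (by simp [hx])
    rw [map_sub, aeval_X, aeval_C, sub_eq_zero] at h0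
    refine ⟨f, ?_, by simp⟩
    rw [h0, IsIdempotentElem, ← map_mul, hsq]
  have heig' : ∀ a : ZMod 2, ∀ x, f x = a • x → x = 0 := fun a x hx =>
    by_contra fun hx0 => heig ⟨a, x, hx, hx0⟩
  -- Idempotency asks that `w i * (d i + w k - 1) = 0` for `i < k`. A constant `d = 1 - w k` works
  -- whenever the trace forces that `w k`: this fails only for trace 0 and `k` odd.
  rcases h01 (LinearMap.trace (ZMod 2) V f) with htr | htr
  swap
  · refine hf.isNilClean_of_diagonal hv hk (fun _ => 0) (fun _ => hsq _) fun w _ ht => ?_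
    have hw : w (Fin.last k) = 1 := by simpa [htr] using ht.symm
    exact ⟨hsq _, fun i => by simp [hw]⟩
  rcases Nat.even_or_odd k with hkp | hkp
  · refine hf.isNilClean_of_diagonal hv hk (fun _ => 1) (fun _ => hsq _) fun w _ ht => ?_
    have hw : w (Fin.last k) = 0 := by
      simpa [htr, (ZMod.natCast_eq_zero_iff_even).2 hkp] using ht.symm
    exact ⟨hsq _, fun i => by simp [hw]⟩
  · obtain ⟨j, rfl⟩ := Nat.exists_eq_succ_of_ne_zero hkp.pos.ne'
    have hj : Even j := by simpa [Nat.odd_add_one] using hkp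
    rw [Nat.succ_eq_add_one] at hk
    -- One zero node corrects the parity, at the price of needing `w 1 = 0`. Since `r` has no roots,
    -- its values at 1 and 0 give `w 0 = 1`, then `w 1 = 0`.
    set d : ℕ → ZMod 2 := fun i => if i = 1 then 0 else 1 with hd
    refine hf.isNilClean_of_diagonal hv hk d (fun _ => hsq _) fun w hrel ht => ?_
    set r := X * newtonPoly d (j + 1) - ∑ i : Fin (j + 1 + 1), C (w i) * newtonPoly d i with hr
    have hdegs : (∑ i : Fin (j + 1 + 1), C (w i) * newtonPoly d i).natDegree ≤ j + 1 := by
      refine natDegree_sum_le_of_forall_le _ _ fun i _ => (natDegree_C_mul_le _ _).trans ?_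
      rw [newtonPoly_natDegree]
      omega
    have hdegl : (X * newtonPoly d (j + 1)).natDegree = j + 1 + 1 := by
      rw [natDegree_X_mul (newtonPoly_monic d (j + 1)).ne_zero, newtonPoly_natDegree]
    have hdeg : r.natDegree = j + 1 + 1 := by
      rw [hr, natDegree_sub_eq_left_of_natDegree_lt (by omega), hdegl]
    have hr0 : r ≠ 0 := by
      rintro h
      rw [h, natDegree_zero] at hdeg
      omega
    have hdeg_le : r.natDegree ≤ finrank (ZMod 2) V := by rw [hdeg, hk]
    have hroot : ∀ a : ZMod 2, r.eval a = 1 := fun a =>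
      (h01 _).resolve_left (hf.eval_ne_zero hv hr0 hdeg_le hrel (heig' a))
    have heval1 : ∀ i, 0 < i → (newtonPoly d i).eval 1 = 0 := fun i hi => by
      simpa [hd] using newtonPoly_eval_eq_zero d hi
    have heval0 : ∀ i, 1 < i → (newtonPoly d i).eval 0 = 0 := fun i hi => by
      simpa [hd] using newtonPoly_eval_eq_zero d hi
    have hw0 : w 0 = 1 := by
      have h := hroot 1
      rw [hr, eval_sub, eval_mul, heval1 (j + 1) (by omega), eval_finsetSum, Fin.sum_univ_succ,
        Finset.sum_eq_zero fun i _ => by simp [heval1]] at h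
      simpa [newtonPoly, CharTwo.neg_eq] using h
    have hw1 : w 1 = 0 := by
      have h := hroot 0
      rw [hr, eval_sub, eval_mul, eval_X, zero_mul, eval_finsetSum, Fin.sum_univ_succ,
        Fin.sum_univ_succ, Finset.sum_eq_zero fun i _ => by simp [heval0]] at h
      simpa [newtonPoly, CharTwo.neg_eq, hw0, hd] using h
    -- For `j = 0` the zero node lies outside the range, but then the last coordinate is `w 1`
    -- itself.
    have hdsum : j ≠ 0 → ∑ i ∈ Finset.range (j + 1), d i = 0 := fun h0 => by
      obtain ⟨l, rfl⟩ := Nat.exists_eq_succ_of_ne_zero h0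
      have hl : ((l + 1 : ℕ) : ZMod 2) = 0 := (ZMod.natCast_eq_zero_iff_even).2 hj
      rw [Finset.sum_range_succ', Finset.sum_range_succ']
      simpa [hd] using hl
    have hw : w (Fin.last (j + 1)) = 0 := by
      rcases eq_or_ne j 0 with rfl | h0
      · exact hw1
      · simpa [htr, hdsum h0] using ht.symm
    refine ⟨hsq _, fun i => ?_⟩
    by_cases hi : (i : ℕ) = 1
    · have : i.castSucc = 1 := by
        ext
        simp [hi, Nat.mod_eq_of_lt (show 1 < j + 1 + 1 by omega)]
      simp [this, hw1]
    · simp [hw, hd, hi]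

end Irreducible

/-! ### Induction on dimension -/

/-- Every endomorphism of a finite-dimensional space over the field with two elements is
nil-clean. -/
theorem isNilClean_end_zmod_two (n : ℕ) : ∀ {V : Type*} [AddCommGroup V] [Module (ZMod 2) V]
    [FiniteDimensional (ZMod 2) V] (_ : Module.finrank (ZMod 2) V = n)
    (f : Module.End (ZMod 2) V), IsNilClean f := by
  induction n using Nat.strong_induction_on with
  | _ n ih =>
    intro V _ _ _ hn f
    by_cases hf : HasOnlyTrivialInvariants f
    · rcases Nat.eq_zero_or_pos (Module.finrank (ZMod 2) V) with h0 | hpos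
      · have := Module.finrank_zero_iff.1 h0
        exact ⟨0, IsIdempotentElem.zero, 1, Subsingleton.elim _ _⟩
      · exact hf.isNilClean hpos
    · obtain ⟨W, hW, hne⟩ : ∃ W : Submodule (ZMod 2) V, W ≤ W.comap f ∧ ¬ (W = ⊥ ∨ W = ⊤) := by
        simpa [HasOnlyTrivialInvariants] using hf
      obtain ⟨hbot, htop⟩ := not_or.1 hne
      have h1 := Submodule.finrank_lt htop
      have h2 := Submodule.finrank_quotient_add_finrank W
      have h3 : Module.finrank (ZMod 2) W ≠ 0 := fun h => hbot (Submodule.finrank_eq_zero.1 h)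
      exact isNilClean_of_invariant f W hW (ih _ (by omega) rfl _) (ih _ (by omega) rfl _)

/-! ### Matrices over `ℤ/m` -/

/-- If `2` is nilpotent in a nonempty matrix ring over `ℤ/m`, then `m` is a power of two. -/
theorem eq_two_pow_of_isNilpotent_two {m n : ℕ} (hm : 2 ≤ m) (hn : 1 ≤ n)
    (h : IsNilpotent (2 : Matrix (Fin n) (Fin n) (ZMod m))) : ∃ r : ℕ, 1 ≤ r ∧ m = 2 ^ r := by
  obtain ⟨k, hk⟩ := h
  have h0 : ((2 ^ k : ℕ) : ZMod m) = 0 := by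
    have := congrFun (congrFun hk ⟨0, hn⟩) ⟨0, hn⟩
    rw [← Nat.cast_ofNat, ← Nat.cast_pow, ← Matrix.diagonal_natCast,
      Matrix.diagonal_apply_eq] at this
    exact this
  obtain ⟨r, -, hr⟩ := (Nat.dvd_prime_pow Nat.prime_two).1 ((ZMod.natCast_eq_zero_iff _ _).1 h0)
  refine ⟨r, Nat.one_le_iff_ne_zero.2 ?_, hr⟩
  rintro rfl
  omega

/-- Matrices over `ℤ/2^r` reducing to zero modulo two are nilpotent. -/
theorem Matrix.isNilpotent_of_map_castHom_eq_zero {ι : Type*} [Fintype ι] [DecidableEq ι] {r : ℕ}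
    (h : 2 ∣ 2 ^ r) (A : Matrix ι ι (ZMod (2 ^ r)))
    (hA : A.map (ZMod.castHom h (ZMod 2)) = 0) : IsNilpotent A := by
  have hdvd : ∀ i j, ∃ b, A i j = 2 * b := by
    intro i j
    have hij : ZMod.castHom h (ZMod 2) (A i j) = 0 := congrFun (congrFun hA i) j
    obtain ⟨a, ha⟩ := ZMod.natCast_zmod_surjective (A i j)
    rw [← ha, map_natCast, ZMod.natCast_eq_zero_iff] at hij
    obtain ⟨c, rfl⟩ := hij
    exact ⟨c, by rw [← ha]; push_cast; rfl⟩
  choose B hB using hdvd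
  have hAB : A = (2 : ZMod (2 ^ r)) • Matrix.of B := by
    ext i j
    simp [hB]
  refine ⟨r, ?_⟩
  have h2 : (2 : ZMod (2 ^ r)) ^ r = 0 := by
    exact_mod_cast ZMod.natCast_self (2 ^ r)
  rw [hAB, smul_pow, h2, zero_smul]

theorem mainTheorem5 (m n : ℕ) (hm : 2 ≤ m) (hn : 1 ≤ n) :
    IsNilCleanRing (Matrix (Fin n) (Fin n) (ZMod m)) ↔ ∃ r : ℕ, 1 ≤ r ∧ m = 2 ^ r := by
  refine ⟨fun h => eq_two_pow_of_isNilpotent_two hm hn h.isNilpotent_two, ?_⟩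
  rintro ⟨r, hr, rfl⟩
  have hdvd : 2 ∣ 2 ^ r := dvd_pow_self 2 (by omega)
  have h2 : IsNilCleanRing (Matrix (Fin n) (Fin n) (ZMod 2)) :=
    IsNilCleanRing.of_ringEquiv Matrix.toLinAlgEquiv'.toRingEquiv
      fun f => isNilClean_end_zmod_two n (by simp) f
  refine h2.of_surjective_of_ker_isNilpotent (ZMod.castHom hdvd (ZMod 2)).mapMatrix ?_
    fun A hA => Matrix.isNilpotent_of_map_castHom_eq_zero hdvd A hA
  intro A
  choose B hB using fun i j => ZMod.castHom_surjective hdvd (A i j)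
  exact ⟨Matrix.of B, Matrix.ext hB⟩
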